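/- Let $H$ be a real Hilbert space with norm $\|\cdot\|$, let $f\colon H\to\mathbb{R}$ be a convex and lower semicontinuous function, and let $\ell\ge 0$. For $x\in H$ let $\operatorname{prox}_f(x)$ denote the unique minimizer over $y\in H$ of $f(y)+\tfrac12\|x-y\|^2$. Then $f$ is $\ell$-Lipschitz, i.e. $|f(x)-f(y)|\le \ell\|x-y\|$ for all $x,y\in H$, if and only if $$\|x\|-\ell\le\|\operatorname{prox}_f(x+y)-y\|\qquad\text{for all }x,y\in H.$$ -/

import Mathlib

open scoped NNReal

/-- `p` attains the infimum over `y` of `f y + (1/2) ‖x - y‖²`. -/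
def IsProx {H : Type*} [NormedAddCommGroup H] (f : H → ℝ) (x p : H) : Prop :=
  ∀ y : H, f p + (1 / 2 : ℝ) * ‖x - p‖ ^ 2 ≤ f y + (1 / 2 : ℝ) * ‖x - y‖ ^ 2

/-- The proximal operator: `prox f x` is the minimizer of `y ↦ f y + (1/2) ‖x - y‖²`.
On a Hilbert space this minimizer exists and is unique whenever `f` is convex and lower
semicontinuous; where no minimizer exists the value is unspecified. -/
noncomputable def prox {H : Type*} [NormedAddCommGroup H] (f : H → ℝ) (x : H) : H :=
  Classical.epsilon (IsProx f x)

/-!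
For convex `f`, Fermat's rule says that `p` is a proximal point of `z` exactly when `z - p` is a
subgradient of `f` at `p` (`isProx_iff_subgradient`), and proximal points exist and are unique when
`f` is also lower semicontinuous (`exists_isProx`, `IsProx.eq`). The norm condition in the theorem
is equivalent to `‖z - prox f z‖ ≤ ℓ` for all `z`: take `y = prox f (x + y)` in one direction, use
the triangle inequality in the other.

If `f` is `ℓ`-Lipschitz, the subgradient inequality at `p = prox f z`, tested at `z`, gives
`‖z - p‖² ≤ f z - f p ≤ ℓ ‖z - p‖`.

Conversely, the bound makes every subgradient of `f` have norm at most `ℓ`, since a subgradient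
`v` at `p` gives `p = prox f (p + v)`. So `f p ≤ f w + ℓ ‖p - w‖` for every `w` and every `p` at
which `f` has a subgradient. Such points accumulate at any given `x`: the proximal point `p` of `x`
for `t • f`, with `t > 0`, has `t⁻¹ • (x - p)` as a subgradient of `f`, whence `‖x - p‖ ≤ t ℓ`.
Lower semicontinuity carries the inequality from these points to `x`.
-/

section Proximal

variable {H : Type*} [NormedAddCommGroup H] [InnerProductSpace ℝ H] {f : H → ℝ}

/-- Fermat's rule for the proximal problem. -/
theorem isProx_iff_subgradient (hf : ConvexOn ℝ Set.univ f) {z p : H} :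
    IsProx f z p ↔ ∀ w, f p + inner ℝ (z - p) (w - p) ≤ f w := by
  constructor
  · intro h w
    -- Compare `p` with `p + t • (w - p)`, divide by `t` and let `t` tend to `0`.
    have key : ∀ t : ℝ, 0 < t → t ≤ 1 →
        f p + inner ℝ (z - p) (w - p) - f w ≤ t * (‖w - p‖ ^ 2 / 2) := by
      intro t ht ht1
      have h1 := h ((1 - t) • p + t • w)
      have h2 := hf.2 (Set.mem_univ p) (Set.mem_univ w) (sub_nonneg.2 ht1) ht.le (by ring)
      have h3 : z - ((1 - t) • p + t • w) = (z - p) - t • (w - p) := by module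
      rw [h3, norm_sub_sq_real (z - p), inner_smul_right, norm_smul, Real.norm_of_nonneg ht.le] at h1
      simp only [smul_eq_mul] at h2
      refine le_of_mul_le_mul_left ?_ ht
      nlinarith
    refine sub_nonpos.1 (le_of_forall_pos_le_add fun ε hε => ?_)
    have hC : 0 < ‖w - p‖ ^ 2 / 2 + 1 := by positivity
    have := key (min 1 (ε / (‖w - p‖ ^ 2 / 2 + 1))) (by positivity) (min_le_left _ _)
    have h4 : min 1 (ε / (‖w - p‖ ^ 2 / 2 + 1)) * (‖w - p‖ ^ 2 / 2 + 1) ≤ ε :=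
      (le_div_iff₀ hC).1 (min_le_right _ _)
    have h5 : 0 < min 1 (ε / (‖w - p‖ ^ 2 / 2 + 1)) := by positivity
    linarith
  · intro h w
    have h1 : z - w = (z - p) - (w - p) := by abel
    rw [h1, norm_sub_sq_real (z - p)]
    nlinarith [h w, sq_nonneg ‖w - p‖]

theorem IsProx.eq (hf : ConvexOn ℝ Set.univ f) {z p q : H} (hp : IsProx f z p)
    (hq : IsProx f z q) : p = q := by
  have h1 := (isProx_iff_subgradient hf).1 hp q
  have h2 := (isProx_iff_subgradient hf).1 hq p
  have h3 : inner ℝ (z - p) (q - p) + inner ℝ (z - q) (p - q) = ‖p - q‖ ^ 2 := by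
    have : q - p = -(p - q) := by abel
    rw [this, inner_neg_right, neg_add_eq_sub, ← inner_sub_left, sub_sub_sub_cancel_left,
      real_inner_self_eq_norm_sq]
  have h4 : ‖p - q‖ ^ 2 = 0 := le_antisymm (by linarith) (sq_nonneg _)
  exact sub_eq_zero.1 (norm_eq_zero.1 (pow_eq_zero_iff two_ne_zero |>.1 h4))

/-- Lower semicontinuity bounds `f` below near `z`, and convexity along rays from `z` extends this
to a lower bound of linear growth. -/
theorem exists_linear_lower_bound (hf : ConvexOn ℝ Set.univ f) (hlsc : LowerSemicontinuous f)
    (z : H) : ∃ C : ℝ, ∀ y, f z - 1 - C * ‖z - y‖ ≤ f y := by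
  obtain ⟨r, hr, hball⟩ := Metric.eventually_nhds_iff_ball.1 (hlsc z (f z - 1) (by linarith))
  refine ⟨2 / r, fun y => ?_⟩
  rcases lt_or_ge ‖z - y‖ r with h | h
  · have h1 := hball y (by rwa [Metric.mem_ball, dist_comm, dist_eq_norm])
    have : 0 ≤ 2 / r * ‖z - y‖ := by positivity
    linarith
  · have hR : 0 < ‖z - y‖ := hr.trans_le h
    -- The point at distance `r / 2` from `z` on the segment to `y` lies in the ball.
    set s : ℝ := r / 2 / ‖z - y‖ with hs
    have hs0 : 0 < s := by positivity
    have hs1 : s ≤ 1 := (div_le_one hR).2 (by linarith)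
    have h1 := hball ((1 - s) • z + s • y) (by
      have : z - ((1 - s) • z + s • y) = s • (z - y) := by module
      rw [Metric.mem_ball, dist_comm, dist_eq_norm, this, norm_smul,
        Real.norm_of_nonneg hs0.le, hs, div_mul_cancel₀ _ hR.ne']
      linarith)
    have h2 := hf.2 (Set.mem_univ z) (Set.mem_univ y) (sub_nonneg.2 hs1) hs0.le (by ring)
    simp only [smul_eq_mul] at h2
    have h3 : s * (2 / r * ‖z - y‖) = 1 := by
      rw [hs]; field_simp
    refine le_of_mul_le_mul_left ?_ hs0
    nlinarith

/-- The proximal objective is bounded below and, by the parallelogram law, its minimizing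
sequences are Cauchy. -/
theorem exists_isProx [CompleteSpace H] (hf : ConvexOn ℝ Set.univ f)
    (hlsc : LowerSemicontinuous f) (z : H) : ∃ p, IsProx f z p := by
  set F : H → ℝ := fun y => f y + (1 / 2 : ℝ) * ‖z - y‖ ^ 2 with hF
  have hFlsc : LowerSemicontinuous F :=
    hlsc.add (Continuous.lowerSemicontinuous (by fun_prop))
  obtain ⟨C, hC⟩ := exists_linear_lower_bound hf hlsc z
  have hbdd : BddBelow (Set.range F) := by
    refine ⟨f z - 1 - C ^ 2 / 2, ?_⟩
    rintro _ ⟨y, rfl⟩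
    simp only [hF]
    nlinarith [hC y, sq_nonneg (‖z - y‖ - C)]
  have hmid : ∀ a b, ‖a - b‖ ^ 2 ≤ 4 * ((F a - ⨅ y, F y) + (F b - ⨅ y, F y)) := by
    intro a b
    have h1 : (⨅ y, F y) ≤ F ((1 / 2 : ℝ) • a + (1 / 2 : ℝ) • b) := ciInf_le hbdd _
    have h2 := hf.2 (Set.mem_univ a) (Set.mem_univ b) (one_half_pos (α := ℝ)).le
      (one_half_pos (α := ℝ)).le (add_halves 1)
    have h3 := parallelogram_law_with_norm ℝ (z - a) (z - b)
    have h4 : (z - a) + (z - b) = (2 : ℝ) • (z - ((1 / 2 : ℝ) • a + (1 / 2 : ℝ) • b)) := by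
      module
    rw [h4, norm_smul, sub_sub_sub_cancel_left, norm_sub_rev b a] at h3
    norm_num at h3
    simp only [hF, smul_eq_mul] at h1 h2 ⊢
    nlinarith
  choose u hu using fun n : ℕ =>
    exists_lt_of_ciInf_lt (lt_add_of_pos_right (⨅ y, F y) (Nat.one_div_pos_of_nat (α := ℝ) (n := n)))
  have hcauchy : CauchySeq u := by
    refine cauchySeq_of_le_tendsto_0 (fun n : ℕ => √(8 * (1 / ((n : ℝ) + 1)))) ?_ ?_
    · intro n m N hn hm
      rw [dist_eq_norm]
      refine Real.le_sqrt_of_sq_le ((hmid _ _).trans ?_)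
      have := Nat.one_div_le_one_div (α := ℝ) hn
      have := Nat.one_div_le_one_div (α := ℝ) hm
      linarith [hu n, hu m]
    · have := ((tendsto_one_div_add_atTop_nhds_zero_nat (𝕜 := ℝ)).const_mul 8).sqrt
      simpa using this
  obtain ⟨p, hp⟩ := cauchySeq_tendsto_of_complete hcauchy
  refine ⟨p, fun y => le_trans ?_ (ciInf_le hbdd y)⟩
  change F p ≤ _
  by_contra! hlt
  obtain ⟨c, hc1, hc2⟩ := exists_between hlt
  have h1 := hp.eventually (hFlsc p c hc2)
  have h2 : ∀ᶠ n : ℕ in Filter.atTop, (⨅ y, F y) + 1 / ((n : ℝ) + 1) < c := by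
    have := (tendsto_one_div_add_atTop_nhds_zero_nat (𝕜 := ℝ)).const_add (⨅ y, F y)
    rw [add_zero] at this
    exact this.eventually (gt_mem_nhds hc1)
  obtain ⟨n, hn1, hn2⟩ := (h1.and h2).exists
  exact absurd (hu n) (not_lt.2 (hn2.trans hn1).le)

theorem isProx_prox [CompleteSpace H] (hf : ConvexOn ℝ Set.univ f)
    (hlsc : LowerSemicontinuous f) (z : H) : IsProx f z (prox f z) :=
  Classical.epsilon_spec (exists_isProx hf hlsc z)

/-- If the displacement of `prox f` is bounded by `ℓ`, so is every subgradient of `f`. -/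
theorem norm_subgradient_le [CompleteSpace H] (hf : ConvexOn ℝ Set.univ f)
    (hlsc : LowerSemicontinuous f) {ℓ : ℝ} (h : ∀ z, ‖z - prox f z‖ ≤ ℓ) {p v : H}
    (hv : ∀ w, f p + inner ℝ v (w - p) ≤ f w) : ‖v‖ ≤ ℓ := by
  have hp : IsProx f (p + v) p :=
    (isProx_iff_subgradient hf).2 (by simpa only [add_sub_cancel_left] using hv)
  have := h (p + v)
  rwa [(isProx_prox hf hlsc _).eq hf hp, add_sub_cancel_left] at this

theorem le_add_mul_norm_sub_of_norm_sub_prox_le [CompleteSpace H]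
    (hf : ConvexOn ℝ Set.univ f) (hlsc : LowerSemicontinuous f) {ℓ : ℝ}
    (h : ∀ z, ‖z - prox f z‖ ≤ ℓ) (x w : H) : f x ≤ f w + ℓ * ‖x - w‖ := by
  have hℓ : 0 ≤ ℓ := (norm_nonneg _).trans (h x)
  have hex : ∀ t : ℝ, 0 < t → ∃ p, ‖x - p‖ ≤ t * ℓ ∧ f p ≤ f w + ℓ * ‖p - w‖ := by
    intro t ht
    have hconv : ConvexOn ℝ Set.univ (fun y => t * f y) := hf.smul ht.le
    have hlsc' : LowerSemicontinuous (fun y => t * f y) := by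
      intro y c hc
      filter_upwards [hlsc y (c / t) ((div_lt_iff₀' ht).2 hc)] with y' hy'
      exact (div_lt_iff₀' ht).1 hy'
    obtain ⟨p, hp⟩ := exists_isProx hconv hlsc' x
    have hsub : ∀ y, f p + inner ℝ (t⁻¹ • (x - p)) (y - p) ≤ f y := by
      intro y
      have h1 := (isProx_iff_subgradient hconv).1 hp y
      refine le_of_mul_le_mul_left ?_ ht
      rw [real_inner_smul_left, mul_add, mul_inv_cancel_left₀ ht.ne']
      exact h1
    have hv := norm_subgradient_le hf hlsc h hsub
    refine ⟨p, ?_, ?_⟩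
    · rwa [norm_smul, Real.norm_of_nonneg (inv_nonneg.2 ht.le), inv_mul_le_iff₀ ht] at hv
    · have h1 := hsub w
      have h2 := neg_le_of_abs_le (abs_real_inner_le_norm (t⁻¹ • (x - p)) (w - p))
      have h3 := mul_le_mul_of_nonneg_right hv (norm_nonneg (w - p))
      rw [norm_sub_rev p w]
      linarith
  by_contra! hlt
  obtain ⟨c, hc1, hc2⟩ := exists_between hlt
  have hcont : ContinuousAt (fun p => f w + ℓ * ‖p - w‖) x := by fun_prop
  obtain ⟨r, hr, hball⟩ := Metric.eventually_nhds_iff_ball.1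
    ((hlsc x c hc2).and (hcont.eventually (gt_mem_nhds hc1)))
  -- This scale makes `t * ℓ < r`, also when `ℓ = 0`.
  obtain ⟨p, hp, hpw⟩ := hex (r / (ℓ + 1)) (by positivity)
  have hpr : ‖x - p‖ < r := by
    refine hp.trans_lt ?_
    rw [div_mul_eq_mul_div, div_lt_iff₀ (by positivity)]
    nlinarith
  have := hball p (by rwa [Metric.mem_ball, dist_comm, dist_eq_norm])
  linarith [this.1, this.2]

theorem LipschitzWith.norm_sub_prox_le [CompleteSpace H] {ℓ : ℝ≥0} (h : LipschitzWith ℓ f)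
    (hf : ConvexOn ℝ Set.univ f) (hlsc : LowerSemicontinuous f) (z : H) :
    ‖z - prox f z‖ ≤ ℓ := by
  have h1 := (isProx_iff_subgradient hf).1 (isProx_prox hf hlsc z) z
  have h2 := (le_abs_self _).trans (h.dist_le_mul z (prox f z))
  rw [real_inner_self_eq_norm_sq] at h1
  rw [dist_eq_norm] at h2
  rcases (norm_nonneg (z - prox f z)).eq_or_lt with h0 | h0
  · exact h0 ▸ ℓ.2
  · refine le_of_mul_le_mul_right ?_ h0
    nlinarith

end Proximal

theorem mainTheorem4 {H : Type*} [NormedAddCommGroup H] [InnerProductSpace ℝ H]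
    [CompleteSpace H] (f : H → ℝ) (hconv : ConvexOn ℝ Set.univ f)
    (hlsc : LowerSemicontinuous f) (ℓ : ℝ≥0) :
    LipschitzWith ℓ f ↔ ∀ x y : H, ‖x‖ - (ℓ : ℝ) ≤ ‖prox f (x + y) - y‖ := by
  constructor
  · intro h x y
    have h1 := h.norm_sub_prox_le hconv hlsc (x + y)
    have h2 : x = (x + y - prox f (x + y)) + (prox f (x + y) - y) := by abel
    have h3 := norm_add_le (x + y - prox f (x + y)) (prox f (x + y) - y)
    rw [← h2] at h3
    linarith
  · intro h
    have hprox : ∀ z, ‖z - prox f z‖ ≤ ℓ := by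
      intro z
      simpa using h (z - prox f z) (prox f z)
    refine LipschitzWith.of_le_add_mul ℓ fun x w => ?_
    rw [dist_eq_norm]
    exact le_add_mul_norm_sub_of_norm_sub_prox_le hconv hlsc hprox x w
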